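/- Let $n\ge 3$, $\sigma^*>0$ and $\delta>0$, and assume that we observe the random vector $\boldsymbol y=\boldsymbol f^*+\boldsymbol\xi$, where $\boldsymbol f^*\in\mathbb R^n$ is fixed and $\boldsymbol\xi\sim\sigma^*\mathcal N(0,\mathbf I_n)$, that is, $\boldsymbol\xi$ is $\sigma^*$ times a standard Gaussian vector in $\mathbb R^n$. For $\boldsymbol f\in\mathbb R^n$ put $\|\boldsymbol f\|_{\rm TV}=\sum_{i=1}^n|f_i-f_{i-1}|$ with the convention $f_0=0$. Let $\boldsymbol f^\uparrow$ be the orthogonal (nearest-point) projection of $\boldsymbol f^*$ on the closed convex cone of vectors in $\mathbb R^n$ with nondecreasing entries, and let $k$ be the smallest integer (strictly) larger than $$\Big(\frac{\|\boldsymbol f^\uparrow\|_{\rm TV}^2\,n\log(n/\delta)}{\sigma^{*2}}\Big)^{1/3}.$$ Let $\lambda=\sigma^*\sqrt{\log(n/\delta)/(kn)}$ and let $\widehat{\boldsymbol f}$ be the TV-estimator with tuning parameter $\lambda$, that is, $$\widehat{\boldsymbol f}\in\arg\min_{\boldsymbol f\in\mathbb R^n}\Big\{\frac1n\|\boldsymbol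 y-\boldsymbol f\|_2^2+\lambda\|\boldsymbol f\|_{\rm TV}\Big\}.$$ Then, with probability at least $1-2\delta$, $$\frac1n\|\widehat{\boldsymbol f}-\boldsymbol f^*\|_2^2\le\frac1n\|\boldsymbol f^\uparrow-\boldsymbol f^*\|_2^2+\frac{2\sigma^{*2}(1+2\log(1/\delta))}{n}+6\Big(\frac{\sigma^{*4}\|\boldsymbol f^\uparrow\|_{\rm TV}^2\log(n/\delta)}{n^2}\Big)^{1/3}.$$ (For $\delta\ge 1/2$ the claim is trivial.) -/

import Mathlib

open MeasureTheory ProbabilityTheory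

/-- Total variation of a vector `f ∈ ℝⁿ`: the sum over `i = 1, …, n` of `|f_i - f_{i-1}|`,
with the convention `f_0 = 0` (the entries are `f_1, …, f_n`; the index `i : Fin n` stands for
the position `i + 1`). In particular `|f_1|` is one of the summands. -/
noncomputable def tvNorm {n : ℕ} (f : EuclideanSpace ℝ (Fin n)) : ℝ :=
  ∑ i : Fin n, |f i - if h : 0 < (i : ℕ) then f ⟨(i : ℕ) - 1, by omega⟩ else 0|

/-- The objective `(1/n) ‖y - f‖₂² + lam * ‖f‖_TV` of total-variation penalized least squares. -/
noncomputable def tvObjective {n : ℕ} (y : EuclideanSpace ℝ (Fin n)) (lam : ℝ)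
    (f : EuclideanSpace ℝ (Fin n)) : ℝ :=
  1 / (n : ℝ) * ‖y - f‖ ^ 2 + lam * tvNorm f

/-- `f` is a TV-estimator for the data `y` and the tuning parameter `lam`: it is a global
minimizer of the penalized least squares objective. -/
def IsTVEstimator {n : ℕ} (y : EuclideanSpace ℝ (Fin n)) (lam : ℝ)
    (f : EuclideanSpace ℝ (Fin n)) : Prop :=
  ∀ g : EuclideanSpace ℝ (Fin n), tvObjective y lam f ≤ tvObjective y lam g

/-- The cone of vectors with nondecreasing entries. -/
def monotoneCone (n : ℕ) : Set (EuclideanSpace ℝ (Fin n)) :=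
  {f | ∀ i j : Fin n, i ≤ j → f i ≤ f j}

theorem monotoneCone_exists_nearest {n : ℕ} (f : EuclideanSpace ℝ (Fin n)) :
    ∃ g ∈ monotoneCone n, ∀ h ∈ monotoneCone n, ‖f - g‖ ≤ ‖f - h‖ := by
  have hne : (monotoneCone n).Nonempty := ⟨0, fun i j _ => le_refl _⟩
  have hcl : IsClosed (monotoneCone n) := by
    simp only [monotoneCone, Set.ofPred_forall]
    refine isClosed_iInter fun i => isClosed_iInter fun j => isClosed_iInter fun _ => ?_
    exact isClosed_le (by fun_prop) (by fun_prop)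
  obtain ⟨g, hg, hd⟩ := hcl.exists_infDist_eq_dist hne f
  refine ⟨g, hg, fun h hh => ?_⟩
  rw [← dist_eq_norm, ← dist_eq_norm, ← hd]
  exact Metric.infDist_le_dist_of_mem hh

/-- The orthogonal (that is, nearest-point) projection of `f` on the closed convex cone of vectors
with nondecreasing entries. -/
noncomputable def monotoneProj {n : ℕ} (f : EuclideanSpace ℝ (Fin n)) :
    EuclideanSpace ℝ (Fin n) :=
  (monotoneCone_exists_nearest f).choose

theorem monotoneProj_mem {n : ℕ} (f : EuclideanSpace ℝ (Fin n)) :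
    monotoneProj f ∈ monotoneCone n :=
  (monotoneCone_exists_nearest f).choose_spec.1

theorem norm_sub_monotoneProj_le {n : ℕ} (f : EuclideanSpace ℝ (Fin n))
    {h : EuclideanSpace ℝ (Fin n)} (hh : h ∈ monotoneCone n) :
    ‖f - monotoneProj f‖ ≤ ‖f - h‖ :=
  (monotoneCone_exists_nearest f).choose_spec.2 h hh

/-! Split the noise as `c + r`, where the inner products of `c` with the step vectors (its tail
sums) are at most `n * lam / 2`. By summation by parts the penalty absorbs `c`, and convexity gives,
for every `g`, `‖f̂ - f*‖² ≤ ‖g - f*‖² + ‖r‖² + 2 n lam ‖g‖_TV` (`IsTVEstimator.norm_sub_sq_le`);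
then take `g = f↑`.

With `ξ = σ z`, the remainder is `r = σ T z`, where `T` is the identity on vectors constant on at
most `2 k` blocks and multiplication by a small `ρ` on the orthogonal complement. A step vector
differs from a blockwise constant one in a single block, so the tail sums of `z - T z` have variance
at most `n / (8 k)` (`exists_subspace_shrinkage`), and the Gaussian level `√(2 log (n/δ))` matches
`lam`. A Chernoff bound at exponent `1/4` gives `‖T z‖² ≤ 4 k - 2 + 4 log (1/δ)`. The choice of `k`
balances this against the penalty: they contribute `4 K` and `2 K` to the final constant `6`. -/

open scoped RealInnerProductSpace

/-! ### Total variation and summation by parts -/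

/-- The `j`-th column of the cumulative sum design: the indicator of the positions `i ≥ j`. -/
noncomputable def stepVec {n : ℕ} (j : Fin n) : EuclideanSpace ℝ (Fin n) :=
  WithLp.toLp 2 fun i => if j ≤ i then 1 else 0

/-- The increment of `f` at `i`, with the convention that `f` vanishes before its first entry. -/
noncomputable def increment {n : ℕ} (f : EuclideanSpace ℝ (Fin n)) (i : Fin n) : ℝ :=
  f i - if h : 0 < (i : ℕ) then f ⟨(i : ℕ) - 1, by omega⟩ else 0

theorem increment_add_smul {n : ℕ} (f g : EuclideanSpace ℝ (Fin n)) (a b : ℝ) (i : Fin n) :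
    increment (a • f + b • g) i = a * increment f i + b * increment g i := by
  unfold increment
  split_ifs <;> simp <;> ring

theorem tvNorm_nonneg {n : ℕ} (f : EuclideanSpace ℝ (Fin n)) : 0 ≤ tvNorm f :=
  Finset.sum_nonneg fun _ _ => abs_nonneg _

theorem tvNorm_add_smul_le {n : ℕ} (f g : EuclideanSpace ℝ (Fin n)) (a b : ℝ) :
    tvNorm (a • f + b • g) ≤ |a| * tvNorm f + |b| * tvNorm g := by
  change ∑ i, |increment _ i| ≤ |a| * ∑ i, |increment f i| + |b| * ∑ i, |increment g i|
  rw [Finset.mul_sum, Finset.mul_sum, ← Finset.sum_add_distrib]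
  refine Finset.sum_le_sum fun i _ => ?_
  rw [increment_add_smul, ← abs_mul, ← abs_mul]
  exact abs_add_le _ _

theorem sum_increment {n : ℕ} (f : EuclideanSpace ℝ (Fin n)) (i : Fin n) :
    ∑ j, increment f j * (if j ≤ i then 1 else 0) = f i := by
  obtain ⟨i, hi⟩ := i
  induction i with
  | zero =>
    rw [Finset.sum_eq_single (⟨0, hi⟩ : Fin n)]
    · simp [increment]
    · intro j _ hj
      have : ¬ j ≤ ⟨0, hi⟩ := fun h => hj (Fin.ext (Nat.le_zero.mp h))
      simp [this]
    · simp
  | succ m ih =>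
    have hm : m < n := by omega
    have key : ∀ j : Fin n, increment f j * (if j ≤ ⟨m + 1, hi⟩ then 1 else 0) =
        increment f j * (if j ≤ ⟨m, hm⟩ then 1 else 0) +
          if j = ⟨m + 1, hi⟩ then increment f j else 0 := by
      intro j
      by_cases h1 : j = ⟨m + 1, hi⟩
      · subst h1; simp
      · have h2 : (j ≤ ⟨m + 1, hi⟩) ↔ j ≤ ⟨m, hm⟩ := by
          have : (j : ℕ) ≠ m + 1 := fun h => h1 (Fin.ext h)
          simp only [Fin.le_def]; omega
        simp [h1, h2]
    simp_rw [key]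
    rw [Finset.sum_add_distrib, ih hm, Finset.sum_ite_eq' Finset.univ]
    simp [increment]

/-- Summation by parts: a vector is the combination of the step vectors with its increments as
coefficients. -/
theorem sum_increment_smul_stepVec {n : ℕ} (f : EuclideanSpace ℝ (Fin n)) :
    ∑ j, increment f j • stepVec j = f := by
  ext i
  simpa [stepVec] using sum_increment f i

/-- Duality: in the step basis the coefficients of `u` are its increments, whose ℓ¹ norm is the
penalty, so a sup bound on the tail sums of `c` suffices. -/
theorem inner_le_mul_tvNorm {n : ℕ} (c u : EuclideanSpace ℝ (Fin n)) (B : ℝ)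
    (hc : ∀ j, |⟪stepVec j, c⟫| ≤ B) : ⟪c, u⟫ ≤ B * tvNorm u := by
  conv_lhs => rw [← sum_increment_smul_stepVec u, inner_sum]
  change _ ≤ B * ∑ i, |increment u i|
  rw [Finset.mul_sum]
  refine Finset.sum_le_sum fun j _ => ?_
  rw [real_inner_smul_right, real_inner_comm]
  calc _ ≤ |increment u j * ⟪stepVec j, c⟫| := le_abs_self _
    _ = |⟪stepVec j, c⟫| * |increment u j| := by rw [abs_mul, mul_comm]
    _ ≤ _ := mul_le_mul_of_nonneg_right (hc j) (abs_nonneg _)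

/-! ### Deterministic oracle inequality -/

/-- First-order optimality of the TV-estimator. -/
theorem IsTVEstimator.inner_le {n : ℕ} (hn : 0 < n) {y f : EuclideanSpace ℝ (Fin n)} {lam : ℝ}
    (hlam : 0 ≤ lam) (hf : IsTVEstimator y lam f) (g : EuclideanSpace ℝ (Fin n)) :
    2 * ⟪y - f, g - f⟫ ≤ n * lam * (tvNorm g - tvNorm f) := by
  have hn' : (0 : ℝ) < n := by exact_mod_cast hn
  have key : ∀ t : ℝ, 0 < t → t ≤ 1 →
      2 * ⟪y - f, g - f⟫ - n * lam * (tvNorm g - tvNorm f) ≤ t * ‖g - f‖ ^ 2 := by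
    intro t ht ht1
    have h1 := hf ((1 - t) • f + t • g)
    have h2 := tvNorm_add_smul_le f g (1 - t) t
    rw [abs_of_nonneg (by linarith), abs_of_pos ht] at h2
    have h3 : ‖y - ((1 - t) • f + t • g)‖ ^ 2 =
        ‖y - f‖ ^ 2 - 2 * (t * ⟪y - f, g - f⟫) + t ^ 2 * ‖g - f‖ ^ 2 := by
      have : y - ((1 - t) • f + t • g) = (y - f) - t • (g - f) := by module
      rw [this, norm_sub_sq_real, real_inner_smul_right, norm_smul, mul_pow, Real.norm_eq_abs,
        sq_abs]
    unfold tvObjective at h1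
    rw [h3] at h1
    have h4 := mul_le_mul_of_nonneg_left h2 hlam
    have h5 : n * (1 / (n : ℝ) * ‖y - f‖ ^ 2 + lam * tvNorm f) ≤
        n * (1 / (n : ℝ) * (‖y - f‖ ^ 2 - 2 * (t * ⟪y - f, g - f⟫) + t ^ 2 * ‖g - f‖ ^ 2) +
        lam * ((1 - t) * tvNorm f + t * tvNorm g)) :=
      mul_le_mul_of_nonneg_left (by linarith) hn'.le
    have h6 : ∀ a b : ℝ, n * (1 / (n : ℝ) * a + b) = a + n * b := fun a b => by field_simp
    rw [h6, h6] at h5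
    have h7 : t * (2 * ⟪y - f, g - f⟫ - n * lam * (tvNorm g - tvNorm f)) ≤
        t * (t * ‖g - f‖ ^ 2) := by linarith
    exact le_of_mul_le_mul_left h7 ht
  by_contra! hcon
  set D := 2 * ⟪y - f, g - f⟫ - n * lam * (tvNorm g - tvNorm f) with hD
  have hDpos : 0 < D := by rw [hD]; linarith
  set N := ‖g - f‖ ^ 2 with hN
  have hN0 : 0 ≤ N := by positivity
  -- Replaces the limit `t → 0`: for this `t` one has `t * N ≤ D / 2 < D`, against `key`.
  have ht0 : 0 < D / (N + D) / 2 := by positivity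
  have ht1 : D / (N + D) ≤ 1 := by rw [div_le_one (by positivity)]; linarith
  have h := key (D / (N + D) / 2) ht0 (by linarith)
  have h8 : D / (N + D) * N ≤ D := by
    rw [div_mul_eq_mul_div, div_le_iff₀ (by positivity)]; nlinarith
  nlinarith

/-- Deterministic oracle inequality: the noise is split into a part `c` in the dual ball of the
penalty and a remainder `r`. -/
theorem IsTVEstimator.norm_sub_sq_le {n : ℕ} (hn : 0 < n)
    {fstar c r f : EuclideanSpace ℝ (Fin n)} {lam : ℝ} (hlam : 0 ≤ lam)
    (hf : IsTVEstimator (fstar + (c + r)) lam f)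
    (hc : ∀ j, |⟪stepVec j, c⟫| ≤ n * lam / 2) (g : EuclideanSpace ℝ (Fin n)) :
    ‖f - fstar‖ ^ 2 ≤ ‖g - fstar‖ ^ 2 + ‖r‖ ^ 2 + 2 * (n * lam * tvNorm g) := by
  have h1 := hf.inner_le hn hlam g
  have h2 := inner_le_mul_tvNorm c (f - g) _ hc
  have h3 : tvNorm (f - g) ≤ tvNorm f + tvNorm g := by
    have := tvNorm_add_smul_le f g 1 (-1)
    simpa [sub_eq_add_neg] using this
  have h4 : n * lam / 2 * tvNorm (f - g) ≤ n * lam / 2 * (tvNorm f + tvNorm g) := by gcongr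
  have h5 : fstar + (c + r) - f = c + r - (f - fstar) := by abel
  have h6 : g - f = -(f - g) := by abel
  rw [h5, h6, inner_neg_right, inner_sub_left, inner_add_left] at h1
  have h7 : ‖g - fstar‖ ^ 2 = ‖f - fstar‖ ^ 2 - 2 * ⟪f - fstar, f - g⟫ + ‖f - g‖ ^ 2 := by
    rw [← norm_sub_sq_real]; congr 2; abel
  -- The `‖f - g‖²` produced here cancels the one in `h7`, so the oracle term keeps constant one;
  -- `tvNorm f` cancels between `h1` and `h4`.
  have h8 : 0 ≤ ‖r - (f - g)‖ ^ 2 := by positivity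
  rw [norm_sub_sq_real] at h8
  linarith

/-! ### One-dimensional Gaussian moments and tails -/

theorem gaussianPDFReal_zero_one (x : ℝ) :
    gaussianPDFReal 0 1 x = (√(2 * Real.pi))⁻¹ * Real.exp (-(1 / 2) * x ^ 2) := by
  simp only [gaussianPDFReal, NNReal.coe_one, mul_one, sub_zero]
  congr 2; ring

theorem gaussianPDFReal_smul_exp_sq (a x : ℝ) :
    gaussianPDFReal 0 1 x • Real.exp (a * x ^ 2) =
      (√(2 * Real.pi))⁻¹ * Real.exp (-(1 / 2 - a) * x ^ 2) := by
  rw [gaussianPDFReal_zero_one, smul_eq_mul, mul_assoc, ← Real.exp_add]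
  congr 2; ring

theorem integrable_exp_sq_gaussianReal {a : ℝ} (ha : a < 1 / 2) :
    Integrable (fun x => Real.exp (a * x ^ 2)) (gaussianReal 0 1) := by
  rw [gaussianReal_of_var_ne_zero _ one_ne_zero,
    integrable_withDensity_iff_integrable_smul' (measurable_gaussianPDF 0 1)
      (by simp [gaussianPDF_lt_top])]
  simp_rw [toReal_gaussianPDF, gaussianPDFReal_smul_exp_sq]
  exact (integrable_exp_neg_mul_sq (by linarith)).const_mul _

theorem integral_exp_sq_gaussianReal {a : ℝ} (ha : a < 1 / 2) :
    ∫ x, Real.exp (a * x ^ 2) ∂(gaussianReal 0 1) = (√(1 - 2 * a))⁻¹ := by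
  rw [integral_gaussianReal_eq_integral_smul one_ne_zero]
  simp_rw [gaussianPDFReal_smul_exp_sq]
  rw [integral_const_mul, integral_gaussian, ← Real.sqrt_inv, ← Real.sqrt_inv,
    ← Real.sqrt_mul (by positivity)]
  congr 1
  have : 1 - 2 * a ≠ 0 := by linarith
  have h2 : 1 / 2 - a ≠ 0 := by linarith
  field_simp

/-- Mills ratio bound for the standard Gaussian upper tail. -/
theorem gaussianReal_real_Ioi_le {t : ℝ} (ht : 0 < t) :
    (gaussianReal 0 1).real (Set.Ioi t) ≤
      (√(2 * Real.pi))⁻¹ / t * Real.exp (-(1 / 2) * t ^ 2) := by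
  have hnn : 0 ≤ ∫ x in Set.Ioi t, gaussianPDFReal 0 1 x :=
    setIntegral_nonneg measurableSet_Ioi fun x _ => gaussianPDFReal_nonneg 0 1 x
  rw [measureReal_def, gaussianReal_apply_eq_integral 0 one_ne_zero, ENNReal.toReal_ofReal hnn]
  set C := (√(2 * Real.pi))⁻¹ / t with hC
  have hC0 : 0 ≤ C := by positivity
  have hderiv : ∀ x ∈ Set.Ioi t, HasDerivAt (fun x => -C * Real.exp (-(1 / 2) * x ^ 2))
      (C * x * Real.exp (-(1 / 2) * x ^ 2)) x := by
    intro x _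
    have := (((hasDerivAt_pow 2 x).const_mul (-(1 / 2 : ℝ))).exp).const_mul (-C)
    exact this.congr_deriv (by simp only [Nat.cast_ofNat]; ring)
  have hcont : ContinuousWithinAt (fun x => -C * Real.exp (-(1 / 2) * x ^ 2)) (Set.Ici t) t :=
    Continuous.continuousWithinAt (by fun_prop)
  have hlim : Filter.Tendsto (fun x : ℝ => -C * Real.exp (-(1 / 2) * x ^ 2)) Filter.atTop
      (nhds 0) := by
    rw [← mul_zero (-C)]
    refine (Real.tendsto_exp_atBot.comp ?_).const_mul _
    exact (Filter.tendsto_pow_atTop two_ne_zero).const_mul_atTop_of_neg (by norm_num)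
  have hint := integrableOn_Ioi_deriv_of_nonneg hcont hderiv
    (fun x hx => by have : 0 < x := ht.trans hx; positivity) hlim
  have hval := integral_Ioi_of_hasDerivAt_of_tendsto hcont hderiv hint hlim
  calc ∫ x in Set.Ioi t, gaussianPDFReal 0 1 x
      ≤ ∫ x in Set.Ioi t, C * x * Real.exp (-(1 / 2) * x ^ 2) := by
        refine setIntegral_mono_on (integrable_gaussianPDFReal 0 1).integrableOn hint
          measurableSet_Ioi fun x hx => ?_
        rw [gaussianPDFReal_zero_one]
        refine mul_le_mul_of_nonneg_right ?_ (Real.exp_nonneg _)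
        rw [hC, div_mul_eq_mul_div, le_div_iff₀ ht]
        exact mul_le_mul_of_nonneg_left (le_of_lt hx) (by positivity)
    _ = C * Real.exp (-(1 / 2) * t ^ 2) := by rw [hval]; ring

theorem gaussianReal_real_abs_gt_le {t : ℝ} (ht : 0 < t) (ht2 : 2 ≤ t ^ 2) :
    (gaussianReal 0 1).real {x | t < |x|} ≤ 0.57 * Real.exp (-(1 / 2) * t ^ 2) := by
  have hset : {x : ℝ | t < |x|} = Set.Ioi t ∪ (fun x => -x) ⁻¹' Set.Ioi t := by
    ext x; simp [lt_abs, lt_neg]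
  have hneg : (gaussianReal 0 1).real ((fun x => -x) ⁻¹' Set.Ioi t) =
      (gaussianReal 0 1).real (Set.Ioi t) := by
    have := gaussianReal_map_neg (μ := 0) (v := 1)
    rw [neg_zero] at this
    rw [← map_measureReal_apply measurable_neg measurableSet_Ioi]
    exact congrArg (fun m : Measure ℝ => m.real (Set.Ioi t)) this
  rw [hset]
  refine (measureReal_union_le _ _).trans ?_
  rw [hneg]
  have h1 := gaussianReal_real_Ioi_le ht
  -- Since `t² ≥ 2`, the left side is at most `1 / √(4π) ≈ 0.282`.
  have h2 : (√(2 * Real.pi))⁻¹ / t ≤ 0.285 := by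
    rw [inv_eq_one_div, div_div, div_le_iff₀ (by positivity)]
    have h3 : (1 / 0.285 : ℝ) ≤ √(2 * Real.pi * t ^ 2) := by
      apply Real.le_sqrt_of_sq_le
      nlinarith [Real.pi_gt_d2]
    rw [Real.sqrt_mul (by positivity), Real.sqrt_sq ht.le] at h3
    rw [div_le_iff₀ (by norm_num)] at h3
    linarith
  have h4 := mul_le_mul_of_nonneg_right h2 (Real.exp_nonneg (-(1 / 2) * t ^ 2))
  linarith

/-! ### Gaussian vectors and the shrinkage operator -/

theorem norm_sq_apply_sum_smul {ι E : Type*} [Fintype ι] [NormedAddCommGroup E]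
    [InnerProductSpace ℝ E] (b : OrthonormalBasis ι ℝ E) (T : E →L[ℝ] E) (w : ι → ℝ) (hT : ∀ i, T (b i) = w i • b i) (x : ι → ℝ) :
    ‖T (∑ i, x i • b i)‖ ^ 2 = ∑ i, w i ^ 2 * x i ^ 2 := by
  have h : T (∑ i, x i • b i) = ∑ i, (w i * x i) • b i := by
    simp [map_sum, hT, smul_smul, mul_comm]
  rw [h, ← real_inner_self_eq_norm_sq, b.orthonormal.inner_sum]
  exact Finset.sum_congr rfl fun i _ => by simp; ring

section

variable {E : Type*} [NormedAddCommGroup E] [InnerProductSpace ℝ E] [FiniteDimensional ℝ E]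
  [MeasurableSpace E] [BorelSpace E]

theorem map_inner_stdGaussian (a : E) :
    (stdGaussian E).map (fun x => ⟪a, x⟫) =
      (gaussianReal 0 1).map (fun z => ‖a‖ * z) := by
  have h := IsGaussian.map_eq_gaussianReal (μ := stdGaussian E) (innerSL ℝ a)
  rw [integral_strongDual_stdGaussian, variance_dual_stdGaussian, innerSL_apply_norm] at h
  rw [gaussianReal_map_const_mul]
  rw [mul_zero, mul_one]
  convert h using 2
  · simp
  · exact (Real.toNNReal_of_nonneg (sq_nonneg _)).symm

theorem stdGaussian_real_abs_inner_gt_le (a : E) {B t : ℝ} (ht : 0 < t) (ht2 : 2 ≤ t ^ 2)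
    (hB : ‖a‖ * t ≤ B) :
    (stdGaussian E).real {x | B < |⟪a, x⟫|} ≤ 0.57 * Real.exp (-(1 / 2) * t ^ 2) := by
  have hs : MeasurableSet {z : ℝ | B < |z|} := measurableSet_lt measurable_const (by fun_prop)
  have h1 : (stdGaussian E).real {x | B < |⟪a, x⟫|} =
      (gaussianReal 0 1).real {z | B < |‖a‖ * z|} := by
    have h2 := congrArg (Measure.real · {z | B < |z|}) (map_inner_stdGaussian a)
    beta_reduce at h2
    rw [map_measureReal_apply (by fun_prop) hs, map_measureReal_apply (by fun_prop) hs] at h2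
    exact h2
  rw [h1]
  refine le_trans (measureReal_mono ?_) (gaussianReal_real_abs_gt_le ht ht2)
  intro z hz
  simp only [Set.mem_ofPred_eq, abs_mul, abs_norm] at hz ⊢
  by_contra! hcon
  have := mul_le_mul_of_nonneg_left hcon (norm_nonneg a)
  linarith

/-- In an orthonormal eigenbasis of `T` the Gaussian coordinates are independent, so the exponential
moment is a product of one-dimensional ones. -/
theorem exp_norm_sq_apply_stdGaussian {ι : Type*} [Fintype ι] (b : OrthonormalBasis ι ℝ E)
    (T : E →L[ℝ] E) (w : ι → ℝ) (hT : ∀ i, T (b i) = w i • b i) (s : ℝ)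
    (hw : ∀ i, s * w i ^ 2 < 1 / 2) :
    Integrable (fun x => Real.exp (s * ‖T x‖ ^ 2)) (stdGaussian E) ∧
      ∫ x, Real.exp (s * ‖T x‖ ^ 2) ∂(stdGaussian E) = ∏ i, (√(1 - 2 * (s * w i ^ 2)))⁻¹ := by
  have hmeas : Measurable (fun x : ι → ℝ => ∑ i, x i • b i) := by fun_prop
  have hfun : ∀ x : ι → ℝ, Real.exp (s * ‖T (∑ i, x i • b i)‖ ^ 2) =
      ∏ i, Real.exp (s * w i ^ 2 * x i ^ 2) := by
    intro x
    rw [norm_sq_apply_sum_smul b T w hT, Finset.mul_sum, Real.exp_sum]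
    simp_rw [mul_assoc]
  have haesm : AEStronglyMeasurable (fun x => Real.exp (s * ‖T x‖ ^ 2)) (Measure.map
      (fun x : ι → ℝ => ∑ i, x i • b i) (Measure.pi fun _ => gaussianReal 0 1)) :=
    Continuous.aestronglyMeasurable (by fun_prop)
  rw [stdGaussian_eq_map_pi_orthonormalBasis b]
  constructor
  · rw [integrable_map_measure haesm hmeas.aemeasurable]
    simp only [Function.comp_def, hfun]
    exact Integrable.fintype_prod (f := fun i y => Real.exp (s * w i ^ 2 * y ^ 2))
      fun i => integrable_exp_sq_gaussianReal (hw i)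
  · rw [integral_map hmeas.aemeasurable haesm]
    simp only [hfun]
    rw [integral_fintype_prod_eq_prod (f := fun i y => Real.exp (s * w i ^ 2 * y ^ 2))]
    exact Finset.prod_congr rfl fun i _ => integral_exp_sq_gaussianReal (hw i)

/-- The linear smoother equal to the identity on `V` and to the multiplication by `ρ` on `Vᗮ`. -/
noncomputable def shrinkOffSubspace (V : Submodule ℝ E) (ρ : ℝ) : E →L[ℝ] E :=
  V.starProjection + ρ • (ContinuousLinearMap.id ℝ E - V.starProjection)

theorem exp_norm_sq_shrinkOffSubspace (V : Submodule ℝ E) {ρ : ℝ} (hρ : ρ ^ 2 ≤ 1) :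
    Integrable (fun x => Real.exp (1 / 4 * ‖shrinkOffSubspace V ρ x‖ ^ 2)) (stdGaussian E) ∧
      ∫ x, Real.exp (1 / 4 * ‖shrinkOffSubspace V ρ x‖ ^ 2) ∂(stdGaussian E) =
        √2 ^ Module.finrank ℝ V * (√(1 - ρ ^ 2 / 2))⁻¹ ^ Module.finrank ℝ Vᗮ := by
  let b := ((stdOrthonormalBasis ℝ V).prod (stdOrthonormalBasis ℝ Vᗮ)).map
    V.orthogonalDecomposition.symm
  have hl : ∀ i, b (Sum.inl i) = (stdOrthonormalBasis ℝ V i : E) := by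
    intro i; simp [b, OrthonormalBasis.prod_apply]
  have hr : ∀ i, b (Sum.inr i) = (stdOrthonormalBasis ℝ Vᗮ i : E) := by
    intro i; simp [b, OrthonormalBasis.prod_apply]
  have h := exp_norm_sq_apply_stdGaussian b (shrinkOffSubspace V ρ)
    (Sum.elim (fun _ => 1) (fun _ => ρ)) ?_ (1 / 4) ?_
  · refine ⟨h.1, h.2.trans ?_⟩
    rw [Fintype.prod_sum_type]
    simp only [Sum.elim_inl, Sum.elim_inr, Finset.prod_const, Finset.card_univ, Fintype.card_fin]
    congr 2
    · rw [← Real.sqrt_inv]; norm_num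
    · congr 2; ring
  · rintro (i | i)
    · rw [hl]
      have : V.starProjection (stdOrthonormalBasis ℝ V i : E) = stdOrthonormalBasis ℝ V i :=
        Submodule.starProjection_eq_self_iff.mpr (Subtype.prop _)
      simp [shrinkOffSubspace, this]
    · rw [hr]
      have : V.starProjection (stdOrthonormalBasis ℝ Vᗮ i : E) = 0 :=
        (Submodule.starProjection_apply_eq_zero_iff V).mpr (Subtype.prop _)
      simp [shrinkOffSubspace, this]
  · rintro (i | i)
    · norm_num
    · simp only [Sum.elim_inr]; linarith

end

/-! ### Block approximation of step vectors -/

/-- The vector whose restriction to the `b`-th block of `M` consecutive positions is constant,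
equal to `g b`. -/
noncomputable def blockMap {n M p : ℕ} (h : n ≤ p * M) :
    (Fin p → ℝ) →ₗ[ℝ] EuclideanSpace ℝ (Fin n) where
  toFun g := WithLp.toLp 2 fun i => g ⟨(i : ℕ) / M, Nat.div_lt_of_lt_mul (by
    rw [mul_comm]; exact i.2.trans_le h)⟩
  map_add' _ _ := by ext; simp
  map_smul' _ _ := by ext; simp

theorem blockMap_injective {n M p : ℕ} (h : n ≤ p * M) (hM : 0 < M) (hp : p * M < n + M) :
    Function.Injective (blockMap h) := by
  intro g g' hgg
  ext b
  have hb : (b : ℕ) * M < n := by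
    have : ((b : ℕ) + 1) * M ≤ p * M := Nat.mul_le_mul_right _ b.2
    rw [add_mul] at this
    omega
  have := congrArg (fun f : EuclideanSpace ℝ (Fin n) => f ⟨(b : ℕ) * M, hb⟩) hgg
  simpa [blockMap, hM] using this

theorem finrank_range_blockMap {n M p : ℕ} (h : n ≤ p * M) (hM : 0 < M) (hp : p * M < n + M) :
    Module.finrank ℝ (LinearMap.range (blockMap h)) = p := by
  rw [LinearMap.finrank_range_of_inj (blockMap_injective h hM hp), Module.finrank_fin_fun]

theorem card_block_le {n M : ℕ} (hM : 0 < M) (q : ℕ) :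
    (Finset.univ.filter fun i : Fin n => (i : ℕ) / M = q).card ≤ M := by
  calc _ ≤ (Finset.Ico (q * M) (q * M + M)).card := by
        refine Finset.card_le_card_of_injOn (fun i => (i : ℕ)) ?_ (Fin.val_injective.injOn)
        intro i hi
        have hi' : (i : ℕ) / M = q := by simpa using hi
        rw [Nat.div_eq_iff hM] at hi'
        simp only [Finset.coe_Ico, Set.mem_Ico]
        omega
    _ = M := by simp

/-- Only the block containing `j` is not constant; the value `1/2` there is off by exactly `1/2` at
each of at most `M` positions. -/
theorem exists_norm_stepVec_sub_blockMap_sq_le {n M p : ℕ} (h : n ≤ p * M) (hM : 0 < M)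
    (j : Fin n) : ∃ g, ‖stepVec j - blockMap h g‖ ^ 2 ≤ M / 4 := by
  refine ⟨fun b => if (j : ℕ) / M < b then 1 else if (j : ℕ) / M = b then 1 / 2 else 0, ?_⟩
  rw [EuclideanSpace.norm_sq_eq]
  have key : ∀ i : Fin n, ‖(stepVec j - blockMap h (fun b => if (j : ℕ) / M < b then (1 : ℝ) else
      if (j : ℕ) / M = b then 1 / 2 else 0)) i‖ ^ 2 =
        if (i : ℕ) / M = (j : ℕ) / M then 1 / 4 else 0 := by
    intro i
    simp only [stepVec, blockMap, LinearMap.coe_mk, AddHom.coe_mk, PiLp.sub_apply, Real.norm_eq_abs,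
      sq_abs]
    rcases lt_trichotomy ((i : ℕ) / M) ((j : ℕ) / M) with hlt | heq | hgt
    · have hij : ¬ j ≤ i := fun hc => absurd (Nat.div_le_div_right (c := M) hc) (by omega)
      simp [hij, hlt.ne, hlt.ne', hlt.le]
    · by_cases hij : j ≤ i
      · simp [hij, heq]; norm_num
      · simp [hij, heq]; norm_num
    · have hij : j ≤ i := by
        by_contra hc
        exact absurd (Nat.div_le_div_right (c := M) (not_le.mp hc).le) (by omega)
      simp [hij, hgt, hgt.ne']
  rw [Finset.sum_congr rfl fun i _ => key i, ← Finset.sum_filter, Finset.sum_const, nsmul_eq_mul]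
  have : ((Finset.univ.filter fun i : Fin n => (i : ℕ) / M = (j : ℕ) / M).card : ℝ) ≤ M := by
    exact_mod_cast card_block_le hM _
  linarith

theorem norm_stepVec_sub_starProjection_sq_le {n M p : ℕ} (h : n ≤ p * M) (hM : 0 < M)
    (j : Fin n) :
    ‖stepVec j - (LinearMap.range (blockMap h)).starProjection (stepVec j)‖ ^ 2 ≤ M / 4 := by
  obtain ⟨g, hg⟩ := exists_norm_stepVec_sub_blockMap_sq_le h hM j
  refine le_trans ?_ hg
  gcongr
  rw [Submodule.starProjection_minimal]
  exact ciInf_le ⟨0, by rintro _ ⟨x, rfl⟩; positivity⟩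
    (⟨blockMap h g, LinearMap.mem_range_self _ _⟩ : LinearMap.range (blockMap h))

/-- Each block carries one direction of weight `1` and at most `M - 1` of weight `ρ ≤ 1 / M`. By
Bernoulli the latter cost a factor at most `8/7` per pair of blocks, as `(M - 1) / M² ≤ 1/4`. -/
theorem moment_factor_le {M k p q : ℕ} {ρ : ℝ} (hM : 0 < M) (hρ0 : 0 ≤ ρ) (hρ : ρ * M ≤ 1)
    (hp : p ≤ 2 * k) (hq : q ≤ p * (M - 1)) :
    √2 ^ p * (√(1 - ρ ^ 2 / 2))⁻¹ ^ q ≤ (16 / 7 : ℝ) ^ k := by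
  have hM1 : (1 : ℝ) ≤ M := by exact_mod_cast hM
  have hρ1 : ρ ≤ 1 := by nlinarith
  have hρ2 : ρ ^ 2 ≤ 1 := by nlinarith
  set v := 1 - ρ ^ 2 / 2 with hv
  have hv0 : 0 < v := by rw [hv]; linarith
  have hv1 : v ≤ 1 := by rw [hv]; nlinarith
  set w := (√v)⁻¹ with hw
  have hw1 : 1 ≤ w := by
    rw [hw]
    exact (one_le_inv₀ (Real.sqrt_pos.mpr hv0)).mpr (Real.sqrt_le_one.mpr hv1)
  have hw2 : w ^ 2 = v⁻¹ := by rw [hw, inv_pow, Real.sq_sqrt hv0.le]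
  have hpow : (7 / 8 : ℝ) ≤ v ^ (M - 1) := by
    have h1 := one_add_mul_le_pow (a := -(ρ ^ 2 / 2)) (by linarith) (M - 1)
    have h2 : (1 : ℝ) + -(ρ ^ 2 / 2) = v := by rw [hv]; ring
    rw [h2, Nat.cast_sub hM, Nat.cast_one] at h1
    have h3 : ((M : ℝ) - 1) * ρ ^ 2 ≤ 1 / 4 := by
      have : 0 ≤ (ρ * M / 2 - ρ) ^ 2 + (1 - ρ * M) * (1 + ρ * M) / 4 := by
        have : 0 ≤ (1 - ρ * M) * (1 + ρ * M) :=
          mul_nonneg (by linarith) (by positivity)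
        positivity
      nlinarith
    linarith
  have hbase : 1 ≤ √2 * w ^ (M - 1) := by
    have h2 : (1 : ℝ) ≤ √2 := Real.one_le_sqrt.mpr (by norm_num)
    have h3 : (1 : ℝ) ≤ w ^ (M - 1) := one_le_pow₀ hw1
    nlinarith
  calc √2 ^ p * w ^ q ≤ √2 ^ p * w ^ (p * (M - 1)) := by
        gcongr
    _ = (√2 * w ^ (M - 1)) ^ p := by rw [mul_pow, ← pow_mul, mul_comm p]
    _ ≤ (√2 * w ^ (M - 1)) ^ (2 * k) := pow_le_pow_right₀ hbase hp
    _ = (2 * (v ^ (M - 1))⁻¹) ^ k := by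
        rw [pow_mul, mul_pow, Real.sq_sqrt (by norm_num), ← pow_mul, mul_comm (M - 1), pow_mul,
          hw2, inv_pow]
    _ ≤ (16 / 7) ^ k := by
        have : (v ^ (M - 1))⁻¹ ≤ 8 / 7 := by
          rw [inv_le_comm₀ (by positivity) (by norm_num)]; linarith
        gcongr
        linarith

/-- With `2 k` blocks of nearly equal lengths, a shrunk block-mean smoother leaves residuals whose
partial sums have variance at most `n / (8 k)` and whose complement has small exponential moment. -/
theorem exists_subspace_shrinkage {n k : ℕ} (hn : 0 < n) (hk : 0 < k) :
    ∃ (V : Submodule ℝ (EuclideanSpace ℝ (Fin n))) (ρ : ℝ), 0 ≤ ρ ∧ ρ ≤ 1 ∧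
      (∀ j : Fin n, ((1 - ρ) * ‖stepVec j - V.starProjection (stepVec j)‖) ^ 2 ≤
        (n : ℝ) / (8 * k)) ∧
      √2 ^ Module.finrank ℝ V * (√(1 - ρ ^ 2 / 2))⁻¹ ^ Module.finrank ℝ Vᗮ ≤ (16 / 7 : ℝ) ^ k := by
  -- Block length `M = ⌈n / (2 k)⌉`; below, `p = ⌈n / M⌉` counts the nonempty blocks.
  obtain ⟨M, hM, hM1, hM2⟩ : ∃ M : ℕ, 0 < M ∧ n ≤ 2 * k * M ∧ 2 * k * M < n + 2 * k := by
    refine ⟨(n + 2 * k - 1) / (2 * k), Nat.div_pos (by omega) (by omega), ?_, ?_⟩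
    · have := Nat.div_add_mod (n + 2 * k - 1) (2 * k)
      have := Nat.mod_lt (n + 2 * k - 1) (show 2 * k > 0 by omega)
      omega
    · have := Nat.mul_div_le (n + 2 * k - 1) (2 * k)
      omega
  obtain ⟨p, hp1, hp2⟩ : ∃ p : ℕ, n ≤ p * M ∧ p * M < n + M := by
    refine ⟨(n + M - 1) / M, ?_, ?_⟩
    · have := Nat.div_add_mod (n + M - 1) M
      have := Nat.mod_lt (n + M - 1) (show M > 0 by omega)
      rw [mul_comm]
      omega
    · have := Nat.div_mul_le_self (n + M - 1) M
      omega
  have hpk : p ≤ 2 * k := by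
    have : p * M < (2 * k + 1) * M := by rw [add_mul]; omega
    exact Nat.lt_succ_iff.mp (Nat.lt_of_mul_lt_mul_right this)
  have hn' : (0 : ℝ) < n := by exact_mod_cast hn
  have hk' : (0 : ℝ) < k := by exact_mod_cast hk
  have hM' : (0 : ℝ) < M := by exact_mod_cast hM
  have hM1' : (n : ℝ) ≤ 2 * k * M := by exact_mod_cast hM1
  have hM2' : 2 * k * (M : ℝ) ≤ n + 2 * k := by exact_mod_cast hM2.le
  -- The factor `1 - ρ = α` undoes the rounding up of `M`: `α² M / 4 ≤ α M / 4 = n / (8 k)`, while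
  -- `ρ M = M - n / (2 k) ≤ 1`.
  set α : ℝ := n / (2 * k * M) with hα
  have hα0 : 0 ≤ α := by positivity
  have hα1 : α ≤ 1 := by rw [hα, div_le_one (by positivity)]; exact hM1'
  have hαM : α * M = n / (2 * k) := by rw [hα]; field_simp
  refine ⟨LinearMap.range (blockMap hp1), 1 - α, by linarith, by linarith, fun j => ?_, ?_⟩
  · have h1 := norm_stepVec_sub_starProjection_sq_le hp1 hM j
    rw [mul_pow, sub_sub_cancel]
    calc _ ≤ α ^ 2 * (M / 4) := by gcongr
      _ = α * (α * M) / 4 := by ring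
      _ ≤ 1 * (α * M) / 4 := by gcongr
      _ = n / (8 * k) := by rw [hαM]; field_simp; norm_num
  · refine moment_factor_le hM (by linarith) ?_ ?_ ?_
    · rw [sub_mul, hαM, one_mul]
      have : (M : ℝ) - 1 ≤ n / (2 * k) := by
        rw [le_div_iff₀ (by positivity)]; linarith
      linarith
    · rw [finrank_range_blockMap hp1 hM hp2]; exact hpk
    · have h1 := Submodule.finrank_add_finrank_orthogonal (LinearMap.range (blockMap hp1))
      rw [finrank_range_blockMap hp1 hM hp2, finrank_euclideanSpace_fin] at h1
      rw [finrank_range_blockMap hp1 hM hp2, Nat.mul_sub, mul_one]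
      omega

/-! ### Probability of a good noise splitting -/

/-- As `16/7 < e`, the worst case is `k = 1`, where the value is about `1.386`. -/
theorem exp_half_sub_mul_pow_le {k : ℕ} (hk : 0 < k) :
    Real.exp (1 / 2 - k) * (16 / 7 : ℝ) ^ k ≤ 1.39 := by
  have he : 16 / 7 * Real.exp (-1) ≤ 1 := by
    rw [Real.exp_neg, ← div_eq_mul_inv, div_le_one (Real.exp_pos _)]
    linarith [Real.exp_one_gt_d9]
  have hhalf : (1.6446 : ℝ) ≤ Real.exp (1 / 2) := by
    refine (pow_le_pow_iff_left₀ (by norm_num) (Real.exp_nonneg _) two_ne_zero).mp ?_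
    rw [← Real.exp_nat_mul]
    norm_num
    linarith [Real.exp_one_gt_d9]
  calc Real.exp (1 / 2 - k) * (16 / 7 : ℝ) ^ k
      = Real.exp (1 / 2) * (16 / 7 * Real.exp (-1)) ^ k := by
        rw [mul_pow, ← Real.exp_nat_mul, sub_eq_add_neg, Real.exp_add]
        ring_nf
    _ ≤ Real.exp (1 / 2) * (16 / 7 * Real.exp (-1)) ^ 1 := by
        exact mul_le_mul_of_nonneg_left (pow_le_pow_of_le_one (by positivity) he hk)
          (Real.exp_nonneg _)
    _ = 16 / 7 * (Real.exp (1 / 2))⁻¹ := by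
        rw [pow_one, ← Real.exp_neg, mul_left_comm, ← Real.exp_add]; norm_num
    _ ≤ 16 / 7 * (1.6446)⁻¹ := by gcongr
    _ ≤ 1.39 := by norm_num

theorem stdGaussian_real_norm_shrinkOffSubspace_gt_le {n k : ℕ} (hk : 0 < k)
    (V : Submodule ℝ (EuclideanSpace ℝ (Fin n))) {ρ : ℝ} (hρ0 : 0 ≤ ρ) (hρ1 : ρ ≤ 1)
    (hV : √2 ^ Module.finrank ℝ V * (√(1 - ρ ^ 2 / 2))⁻¹ ^ Module.finrank ℝ Vᗮ ≤ (16 / 7 : ℝ) ^ k)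
    {δ : ℝ} (hδ : 0 < δ) :
    (stdGaussian (EuclideanSpace ℝ (Fin n))).real
      {z | 4 * k - 2 + 4 * Real.log (1 / δ) < ‖shrinkOffSubspace V ρ z‖ ^ 2} ≤ 1.39 * δ := by
  obtain ⟨hint, hval⟩ := exp_norm_sq_shrinkOffSubspace V (ρ := ρ) (by nlinarith)
  have h1 := mul_meas_ge_le_integral_of_nonneg (Filter.Eventually.of_forall fun z =>
    Real.exp_nonneg (1 / 4 * ‖shrinkOffSubspace V ρ z‖ ^ 2)) hint
    (Real.exp (1 / 4 * (4 * k - 2 + 4 * Real.log (1 / δ))))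
  rw [hval] at h1
  have h2 := h1.trans hV
  have h3 : (stdGaussian (EuclideanSpace ℝ (Fin n))).real
      {z | 4 * k - 2 + 4 * Real.log (1 / δ) < ‖shrinkOffSubspace V ρ z‖ ^ 2} ≤
      (stdGaussian (EuclideanSpace ℝ (Fin n))).real
      {z | Real.exp (1 / 4 * (4 * k - 2 + 4 * Real.log (1 / δ))) ≤
        Real.exp (1 / 4 * ‖shrinkOffSubspace V ρ z‖ ^ 2)} := by
    refine measureReal_mono fun z hz => ?_
    simp only [Set.mem_ofPred_eq] at hz ⊢
    exact Real.exp_le_exp.mpr (by linarith)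
  have h4 : Real.exp (1 / 4 * (4 * k - 2 + 4 * Real.log (1 / δ))) =
      (Real.exp (1 / 2 - k) * δ)⁻¹ := by
    have h : Real.exp (1 / 2 - k) * δ = Real.exp (1 / 2 - k + Real.log δ) := by
      rw [Real.exp_add, Real.exp_log hδ]
    rw [h, ← Real.exp_neg, one_div δ, Real.log_inv]
    congr 1; ring
  refine h3.trans ?_
  rw [h4] at h2 ⊢
  rw [inv_mul_le_iff₀ (by positivity)] at h2
  have h5 := mul_le_mul_of_nonneg_right (exp_half_sub_mul_pow_le hk) hδ.le
  linarith

/-- Self-adjointness moves the operator onto the fixed vector, so each tail sum is a Gaussian linear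
form in `z`. -/
theorem inner_sub_shrinkOffSubspace {E : Type*} [NormedAddCommGroup E] [InnerProductSpace ℝ E]
    [FiniteDimensional ℝ E] (V : Submodule ℝ E) (ρ : ℝ) (x z : E) :
    ⟪x, z - shrinkOffSubspace V ρ z⟫ = ⟪(1 - ρ) • (x - V.starProjection x), z⟫ := by
  have h : z - shrinkOffSubspace V ρ z = (1 - ρ) • (z - V.starProjection z) := by
    simp only [shrinkOffSubspace, add_apply, smul_apply,
      sub_apply, ContinuousLinearMap.id_apply]
    module
  rw [h, real_inner_smul_left, real_inner_smul_right, inner_sub_left, inner_sub_right,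
    Submodule.inner_starProjection_left_eq_right]

/-- A standard Gaussian vector splits, with probability at least `1 - 2 δ`, into a remainder of
small norm and a part with small tail sums. -/
theorem exists_smoother_stdGaussian {n k : ℕ} (hn : 3 ≤ n) (hk : 0 < k) {δ : ℝ} (hδ : 0 < δ)
    (hδ1 : δ < 1 / 2) : ∃ T : EuclideanSpace ℝ (Fin n) →L[ℝ] EuclideanSpace ℝ (Fin n),
      (stdGaussian (EuclideanSpace ℝ (Fin n))).real {z |
        ‖T z‖ ^ 2 ≤ 4 * k - 2 + 4 * Real.log (1 / δ) ∧
        ∀ j, |⟪stepVec j, z - T z⟫| ≤ √(n * Real.log (n / δ) / (4 * k))}ᶜ ≤ 2 * δ := by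
  obtain ⟨V, ρ, hρ0, hρ1, hvar, hmom⟩ := exists_subspace_shrinkage (n := n) (by omega) hk
  refine ⟨shrinkOffSubspace V ρ, ?_⟩
  set T := shrinkOffSubspace V ρ with hT
  set μ := stdGaussian (EuclideanSpace ℝ (Fin n)) with hμ
  set ℓ := Real.log (n / δ) with hℓ
  set B := √(n * ℓ / (4 * k)) with hB
  have hn' : (3 : ℝ) ≤ n := by exact_mod_cast hn
  have hk' : (0 : ℝ) < k := by exact_mod_cast hk
  have hℓ1 : 1 ≤ ℓ := by
    rw [hℓ, Real.le_log_iff_exp_le (by positivity), le_div_iff₀ hδ]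
    nlinarith [Real.exp_one_lt_d9, Real.exp_pos 1]
  have hsub : {z | ‖T z‖ ^ 2 ≤ 4 * k - 2 + 4 * Real.log (1 / δ) ∧
      ∀ j, |⟪stepVec j, z - T z⟫| ≤ B}ᶜ ⊆
      {z | 4 * k - 2 + 4 * Real.log (1 / δ) < ‖T z‖ ^ 2} ∪
        ⋃ j : Fin n, {z | B < |⟪(1 - ρ) • (stepVec j - V.starProjection (stepVec j)), z⟫|} := by
    intro z hz
    simp only [Set.mem_compl_iff, Set.mem_ofPred_eq, not_and_or, not_forall, not_le] at hz
    rcases hz with hz | ⟨j, hj⟩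
    · exact Or.inl hz
    · refine Or.inr (Set.mem_iUnion.mpr ⟨j, ?_⟩)
      rw [inner_sub_shrinkOffSubspace] at hj
      exact hj
  have h1 : μ.real {z | 4 * k - 2 + 4 * Real.log (1 / δ) < ‖T z‖ ^ 2} ≤ 1.39 * δ :=
    stdGaussian_real_norm_shrinkOffSubspace_gt_le hk V hρ0 hρ1 hmom hδ
  have hsq : √(2 * ℓ) ^ 2 = 2 * ℓ := Real.sq_sqrt (by positivity)
  have h2 : ∀ j : Fin n, μ.real
      {z | B < |⟪(1 - ρ) • (stepVec j - V.starProjection (stepVec j)), z⟫|} ≤ 0.57 * (δ / n) := by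
    intro j
    have h := stdGaussian_real_abs_inner_gt_le
      ((1 - ρ) • (stepVec j - V.starProjection (stepVec j))) (B := B) (t := √(2 * ℓ))
      (by positivity) (by rw [hsq]; linarith) ?_
    · rw [hsq] at h
      have : Real.exp (-(1 / 2) * (2 * ℓ)) = δ / n := by
        rw [show -(1 / 2) * (2 * ℓ) = -ℓ by ring, Real.exp_neg, hℓ, Real.exp_log (by positivity),
          inv_div]
      rwa [this] at h
    · rw [hB]
      apply Real.le_sqrt_of_sq_le
      rw [mul_pow, hsq, norm_smul, Real.norm_of_nonneg (by linarith)]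
      calc _ ≤ (n : ℝ) / (8 * k) * (2 * ℓ) := by gcongr; exact hvar j
        _ = _ := by field_simp; norm_num
  have h3 : μ.real (⋃ j : Fin n,
      {z | B < |⟪(1 - ρ) • (stepVec j - V.starProjection (stepVec j)), z⟫|}) ≤ 0.57 * δ := by
    refine (measureReal_iUnion_fintype_le _).trans ((Finset.sum_le_sum fun j _ => h2 j).trans ?_)
    rw [Finset.sum_const, Finset.card_univ, Fintype.card_fin, nsmul_eq_mul]
    apply le_of_eq; field_simp
  have h4 := (measureReal_mono (μ := μ) hsub).trans (measureReal_union_le _ _)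
  -- The two failure probabilities add up to `(1.39 + 0.57) δ = 1.96 δ`.
  linarith

/-! ### Choice of `k` and conclusion -/

/-- The rate `R` and the penalty level in terms of the effective dimension `K`. -/
theorem rate_eq_and_penalty_le {N σ t ℓ K κ : ℝ} (hN : 0 < N) (hσ : 0 < σ) (ht : 0 ≤ t)
    (hℓ : 0 ≤ ℓ) (hK : K = (t ^ 2 * N * ℓ / σ ^ 2) ^ (1 / 3 : ℝ)) (hKκ : K < κ) :
    (σ ^ 4 * t ^ 2 * ℓ / N ^ 2) ^ (1 / 3 : ℝ) = σ ^ 2 * K / N ∧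
      σ * √(ℓ / (κ * N)) * t ≤ σ ^ 2 * K / N := by
  have hbase : 0 ≤ t ^ 2 * N * ℓ / σ ^ 2 := by positivity
  have hK0 : 0 ≤ K := by rw [hK]; positivity
  have hκ : 0 < κ := hK0.trans_lt hKκ
  have hK3 : K ^ 3 = t ^ 2 * N * ℓ / σ ^ 2 := by
    rw [hK, ← Real.rpow_natCast, ← Real.rpow_mul hbase]; norm_num
  constructor
  · have : σ ^ 4 * t ^ 2 * ℓ / N ^ 2 = (σ ^ 2 * K / N) ^ 3 := by
      rw [div_pow, mul_pow, hK3]; field_simp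
    rw [this, ← Real.rpow_natCast, ← Real.rpow_mul (by positivity)]
    norm_num
  · refine (pow_le_pow_iff_left₀ (by positivity) (by positivity) two_ne_zero).mp ?_
    rw [mul_pow, mul_pow, Real.sq_sqrt (by positivity)]
    have h1 : t ^ 2 * ℓ = K ^ 3 * σ ^ 2 / N := by rw [hK3]; field_simp
    calc σ ^ 2 * (ℓ / (κ * N)) * t ^ 2 = σ ^ 2 * (t ^ 2 * ℓ) / (κ * N) := by ring
      _ = σ ^ 4 * K ^ 2 / N ^ 2 * (K / κ) := by rw [h1]; field_simp
      _ ≤ σ ^ 4 * K ^ 2 / N ^ 2 * 1 := by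
          gcongr
          exact (div_le_one hκ).mpr hKκ.le
      _ = (σ ^ 2 * K / N) ^ 2 := by ring

theorem measurableSet_smoother {n : ℕ} (T : EuclideanSpace ℝ (Fin n) →L[ℝ] EuclideanSpace ℝ (Fin n))
    (a B : ℝ) : MeasurableSet {z | ‖T z‖ ^ 2 ≤ a ∧ ∀ j, |⟪stepVec j, z - T z⟫| ≤ B} := by
  have h1 : IsClosed {z | ‖T z‖ ^ 2 ≤ a} := isClosed_le (by fun_prop) continuous_const
  refine (h1.inter ?_).measurableSet
  change IsClosed {z | ∀ j, |⟪stepVec j, z - T z⟫| ≤ B}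
  simp only [Set.ofPred_forall]
  exact isClosed_iInter fun j => isClosed_le (by fun_prop) continuous_const

theorem proposition4p2
    {Ω : Type*} [MeasurableSpace Ω] (P : Measure Ω) [IsProbabilityMeasure P]
    (n : ℕ) (hn : 3 ≤ n) (fstar : EuclideanSpace ℝ (Fin n))
    (σ : ℝ) (hσ : 0 < σ) (δ : ℝ) (hδ : 0 < δ)
    -- the noise is `σ` times a standard Gaussian vector
    (ξ : Ω → EuclideanSpace ℝ (Fin n))
    (hξ : HasLaw ξ
      ((stdGaussian (EuclideanSpace ℝ (Fin n))).map (fun z => σ • z)) P)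
    -- `k` is the smallest integer larger than the displayed real number
    (k : ℕ)
    (hk : IsLeast {m : ℕ |
      (tvNorm (monotoneProj fstar) ^ 2 * n * Real.log (n / δ) / σ ^ 2) ^ (1 / 3 : ℝ) < (m : ℝ)} k)
    (lam : ℝ) (hlam : lam = σ * Real.sqrt (Real.log (n / δ) / (k * n)))
    (fhat : Ω → EuclideanSpace ℝ (Fin n))
    (hfhat : ∀ ω, IsTVEstimator (fstar + ξ ω) lam (fhat ω)) :
    ENNReal.ofReal (1 - 2 * δ) ≤
      P {ω | 1 / (n : ℝ) * ‖fhat ω - fstar‖ ^ 2 ≤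
        1 / (n : ℝ) * ‖monotoneProj fstar - fstar‖ ^ 2
          + 2 * σ ^ 2 * (1 + 2 * Real.log (1 / δ)) / n
          + 6 * (σ ^ 4 * tvNorm (monotoneProj fstar) ^ 2 * Real.log (n / δ) / (n : ℝ) ^ 2)
              ^ (1 / 3 : ℝ)} := by
  rcases le_or_gt (1 / 2) δ with hδ1 | hδ1
  · rw [ENNReal.ofReal_of_nonpos (by linarith)]
    exact zero_le
  have hn' : (3 : ℝ) ≤ n := by exact_mod_cast hn
  have hℓ0 : 0 ≤ Real.log (n / δ) :=
    Real.log_nonneg (by rw [le_div_iff₀ hδ]; linarith)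
  set t := tvNorm (monotoneProj fstar) with ht
  have ht0 : 0 ≤ t := tvNorm_nonneg _
  set K := (t ^ 2 * n * Real.log (n / δ) / σ ^ 2) ^ (1 / 3 : ℝ) with hK
  have hK0 : 0 ≤ K := by positivity
  have hKk : K < k := hk.1
  have hk0 : 0 < k := by exact_mod_cast hK0.trans_lt hKk
  have hk1 : (k : ℝ) - 1 ≤ K := by
    by_contra! hcon
    have hmem : k - 1 ∈ {m : ℕ | K < (m : ℝ)} := by
      change K < ((k - 1 : ℕ) : ℝ)
      rw [Nat.cast_sub hk0, Nat.cast_one]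
      exact hcon
    have := hk.2 hmem
    omega
  have hk' : (0 : ℝ) < k := by exact_mod_cast hk0
  have hlam0 : 0 ≤ lam := by rw [hlam]; positivity
  obtain ⟨hrate, hpen⟩ := rate_eq_and_penalty_le (N := n) (by linarith) hσ ht0 hℓ0 hK hKk
  rw [← hlam] at hpen
  obtain ⟨T, hT⟩ := exists_smoother_stdGaussian hn hk0 hδ hδ1
  have hG := measurableSet_smoother T (4 * k - 2 + 4 * Real.log (1 / δ))
    √(n * Real.log (n / δ) / (4 * k))
  set G := {z | ‖T z‖ ^ 2 ≤ 4 * k - 2 + 4 * Real.log (1 / δ) ∧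
    ∀ j, |⟪stepVec j, z - T z⟫| ≤ √(n * Real.log (n / δ) / (4 * k))} with hGdef
  have hprob : P {ω | σ⁻¹ • ξ ω ∈ G} = stdGaussian (EuclideanSpace ℝ (Fin n)) G := by
    have hS : MeasurableSet {x | σ⁻¹ • x ∈ G} := (measurable_const_smul σ⁻¹) hG
    rw [hξ.measure_eq hS, Measure.map_apply (measurable_const_smul σ) hS]
    congr 1
    ext z
    simp [smul_smul, hσ.ne']
  have hlow : ENNReal.ofReal (1 - 2 * δ) ≤ stdGaussian (EuclideanSpace ℝ (Fin n)) G := by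
    rw [probReal_compl_eq_one_sub hG] at hT
    rw [← ofReal_measureReal]
    exact ENNReal.ofReal_le_ofReal (by linarith)
  refine (hlow.trans_eq hprob.symm).trans (measure_mono fun ω hω => ?_)
  obtain ⟨hr, hc⟩ := hω
  set z := σ⁻¹ • ξ ω with hz
  have hsplit : ξ ω = σ • (z - T z) + σ • T z := by
    rw [← smul_add, sub_add_cancel, hz, smul_smul, mul_inv_cancel₀ hσ.ne', one_smul]
  have hest := hfhat ω
  rw [hsplit] at hest
  -- The level at which tail sums are controlled is exactly the dual radius of the penalty.
  have hlamB : σ * √(n * Real.log (n / δ) / (4 * k)) = n * lam / 2 := by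
    have h1 : n * Real.log (n / δ) / (4 * k) = (n / 2 : ℝ) ^ 2 * (Real.log (n / δ) / (k * n)) := by
      field_simp; norm_num
    rw [h1, Real.sqrt_mul (by positivity), Real.sqrt_sq (by positivity), hlam]
    ring
  have hmain := hest.norm_sub_sq_le (by omega) hlam0 (fun j => by
    rw [real_inner_smul_right, abs_mul, abs_of_pos hσ, ← hlamB]
    exact mul_le_mul_of_nonneg_left (hc j) hσ.le) (monotoneProj fstar)
  rw [norm_smul, mul_pow, Real.norm_of_nonneg hσ.le, ← ht] at hmain
  -- Minimality of `k` gives `k ≤ K + 1`, hence `4 k - 2 ≤ 4 K + 2`; this `2` is the `1` in `1 + 2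
  -- log (1/δ)`.
  have hr' : σ ^ 2 * ‖T z‖ ^ 2 ≤ σ ^ 2 * (4 * K + 2 + 4 * Real.log (1 / δ)) := by
    gcongr; linarith
  have hpen' : n * lam * t ≤ σ ^ 2 * K := by
    rw [le_div_iff₀ (by linarith)] at hpen
    linarith
  change 1 / (n : ℝ) * ‖fhat ω - fstar‖ ^ 2 ≤ _
  rw [hrate]
  calc 1 / (n : ℝ) * ‖fhat ω - fstar‖ ^ 2
      ≤ 1 / (n : ℝ) * (‖monotoneProj fstar - fstar‖ ^ 2 +
          σ ^ 2 * (4 * K + 2 + 4 * Real.log (1 / δ)) + 2 * (σ ^ 2 * K)) := by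
        gcongr; linarith
    _ = _ := by ring
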